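/- Let $d\ge 1$, let $X=\{1,\dots,d\}^{\mathbb N}$ be the Bernoulli space with the shift $\sigma$ and the metric $d_\theta(x,y)=\theta^{N}$, $N$ being the first index at which $x$ and $y$ differ ($d_\theta(x,x)=0$), where $0<\theta<1$ is fixed. Let $f:X\to\mathbb R$ be strictly positive and Lipschitz for $d_\theta$. Write $\mathcal M$ for the set of $\sigma$-invariant Borel probability measures on $X$, $\beta(f)=\sup_{\nu\in\mathcal M}\int f\,d\nu$, $M_{max}(f)=\{\nu\in\mathcal M:\int f\,d\nu=\beta(f)\}$, $k^n=\sum_{i=0}^{n-1}k\circ\sigma^i$, $\mathrm{Fix}_n=\{x\in X:\sigma^n(x)=x\}$, and $P$ for the topological pressure with respect to $\sigma$. For $c\in\mathbb R$ and an integer $N\ge 1$ let $\pi_{c,N}$ and $\eta_{c,N}$ be the probability measures on $X$ such that, for every continuous $k:X\to\mathbb R$, \[ \int k\,d\pi_{c,N}=\frac{\sum_{n=1}^{N}\sum_{x\in \mathrm{Fix}_n}e^{c f^n(x)-nP(cf)}\frac{k^n(x)}{n}}{\sum_{n=1}^{N}\sum_{x\in \mathrm{Fix}_n}e^{c f^n(x)-nP(cf)}},\qquad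 \int k\,d\eta_{c,N}=\frac{\sum_{n=1}^{N}\sum_{x\in \mathrm{Fix}_n}e^{c f^n(x)}\frac{k^n(x)}{n}}{\sum_{n=1}^{N}\sum_{x\in \mathrm{Fix}_n}e^{c f^n(x)}}. \] Then: (1) Every weak* accumulation point of $\pi_{c,N}$ as $c,N\to\infty$ belongs to $M_{max}(f)$, and so does every weak* accumulation point of $\eta_{c,N}$ as $c,N\to\infty$. (2) If $g:X\to\mathbb R$ is continuous and $c_j\to\infty$, $N_j\to\infty$ are such that $\lim_{j\to\infty}\int g\,d\pi_{c_j,N_j}$ exists, then this limit equals $\int g\,d\mu$ for some weak* accumulation point $\mu$ of $\pi_{c,N}$ as $c,N\to\infty$. The same holds for $\eta_{c,N}$. (3) If $M_{max}(f)$ consists of a single measure $\mu_\infty$, then for every continuous $g:X\to\mathbb R$ \[ \lim_{c,N\to\infty}\int g\,d\pi_{c,N}=\lim_{c,N\to\infty}\int g\,d\eta_{c,N}=\int g\,d\mu_\infty . \] -/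

import Mathlib

open Filter Topology MeasureTheory
open scoped ENNReal

noncomputable section

/-- The Bernoulli space on `d` symbols, with the product topology of the discrete topologies and
its Borel σ-algebra. Coordinates are numbered from `0`. -/
abbrev Bernoulli (d : ℕ) : Type := ℕ → Fin d

namespace Bernoulli

variable {d : ℕ}

/-- The left shift `σ`. -/
def shift (x : Bernoulli d) : Bernoulli d := fun n => x (n + 1)

open Classical in
/-- The distance `d_θ(x, y) = θ ^ N`, where `N` is the least place, numbered from `1`, at which
`x` and `y` differ. -/
def thetaDist (θ : ℝ) (x y : Bernoulli d) : ℝ :=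
  if x = y then 0 else θ ^ (PiNat.firstDiff x y + 1)

/-- `f` is Lipschitz for the distance `d_θ`. -/
def IsThetaLipschitz (θ : ℝ) (f : Bernoulli d → ℝ) : Prop :=
  ∃ C : ℝ, ∀ x y : Bernoulli d, |f x - f y| ≤ C * thetaDist θ x y

/-- The cylinder of all sequences that begin with the word `w`. -/
def cylinder {n : ℕ} (w : Fin n → Fin d) : Set (Bernoulli d) := {x | ∀ i : Fin n, x i = w i}

/-- The partition function `∑_{|w| = n} sup_{x ∈ [w]} exp (g^n (x))`. -/
def partitionFunction (g : Bernoulli d → ℝ) (n : ℕ) : ℝ :=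
  ∑ w : Fin n → Fin d, sSup ((fun x => Real.exp (birkhoffSum shift g n x)) '' cylinder w)

/-- The topological pressure `P(g) = lim (1/n) log ∑_{|w| = n} sup_{x ∈ [w]} exp (g^n (x))`.
For continuous `g` the limit exists and is finite, by subadditivity. -/
def pressure (g : Bernoulli d → ℝ) : ℝ :=
  limsup (fun n : ℕ => Real.log (partitionFunction g n) / n) atTop

/-- The set of shift-invariant Borel probability measures. -/
def invariantMeasures (d : ℕ) : Set (ProbabilityMeasure (Bernoulli d)) :=
  {ν | MeasurePreserving (shift : Bernoulli d → Bernoulli d)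
    (ν : Measure (Bernoulli d)) (ν : Measure (Bernoulli d))}

/-- `β(f)`, the supremum of `∫ f dν` over the shift-invariant probability measures. -/
def beta (f : Bernoulli d → ℝ) : ℝ :=
  sSup ((fun ν : ProbabilityMeasure (Bernoulli d) => ∫ x, f x ∂(ν : Measure (Bernoulli d))) ''
    invariantMeasures d)

/-- The set of `f`-maximizing probability measures. -/
def maximizingMeasures (f : Bernoulli d → ℝ) : Set (ProbabilityMeasure (Bernoulli d)) :=
  {ν | ν ∈ invariantMeasures d ∧ ∫ x, f x ∂(ν : Measure (Bernoulli d)) = beta f}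

/-- For `n ≥ 1` there are only finitely many solutions of `σ^n (x) = x`. -/
theorem finite_ptsOfPeriod {n : ℕ} (hn : 1 ≤ n) :
    (Function.ptsOfPeriod (shift : Bernoulli d → Bernoulli d) n).Finite := by
  have key : ∀ (k : ℕ) (x : Bernoulli d) (m : ℕ), shift^[k] x m = x (m + k) := by
    intro k
    induction k with
    | zero => intro x m; rfl
    | succ k ih =>
      intro x m
      rw [Function.iterate_succ_apply, ih]
      rfl
  refine Set.Finite.of_finite_image (f := fun (x : Bernoulli d) (i : Fin n) => x i)
    (Set.toFinite _) ?_
  intro x hx y hy hxy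
  have hx' : ∀ m, x (m + n) = x m := fun m => by
    rw [← key n x m]; exact congrFun hx m
  have hy' : ∀ m, y (m + n) = y m := fun m => by
    rw [← key n y m]; exact congrFun hy m
  funext m
  induction m using Nat.strong_induction_on with
  | _ m ih =>
    by_cases h : m < n
    · exact congrFun hxy ⟨m, h⟩
    · have h1 : m - n + n = m := Nat.sub_add_cancel (not_lt.mp h)
      rw [← h1, hx', hy']
      exact ih _ (by omega)

open Classical in
/-- `Fix_n`, the set of solutions of `σ^n (x) = x`, as a finite set. It is only used for `n ≥ 1`. -/
def fix (d n : ℕ) : Finset (Bernoulli d) :=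
  if h : (Function.ptsOfPeriod (shift : Bernoulli d → Bernoulli d) n).Finite then h.toFinset else ∅

theorem mem_fix {n : ℕ} (hn : 1 ≤ n) (x : Bernoulli d) : x ∈ fix d n ↔ shift^[n] x = x := by
  rw [fix, dif_pos (finite_ptsOfPeriod hn), Set.Finite.mem_toFinset]
  rfl

/-- The measure `(1/n) ∑_{i < n} δ_{σ^i (x)}`, for which `k` has the integral `k^n (x) / n`. -/
def orbitMeasure (n : ℕ) (x : Bernoulli d) : Measure (Bernoulli d) :=
  (n : ℝ≥0∞)⁻¹ • ∑ i ∈ Finset.range n, Measure.dirac (shift^[i] x)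

/-- `∑_{n=1}^N ∑_{x ∈ Fix_n} W n x`. -/
def totalWeight (W : ℕ → Bernoulli d → ℝ) (N : ℕ) : ℝ :=
  ∑ n ∈ Finset.Icc 1 N, ∑ x ∈ fix d n, W n x

/-- The measures on the periodic orbits of period at most `N`, averaged with the weights `W n x`
and normalized. -/
def periodicMeasure (W : ℕ → Bernoulli d → ℝ) (N : ℕ) : Measure (Bernoulli d) :=
  ∑ n ∈ Finset.Icc 1 N, ∑ x ∈ fix d n,
    ENNReal.ofReal (W n x / totalWeight W N) • orbitMeasure n x

theorem isProbabilityMeasure_orbitMeasure {n : ℕ} (hn : 1 ≤ n) (x : Bernoulli d) :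
    IsProbabilityMeasure (orbitMeasure n x) := by
  constructor
  have h : (n : ℝ≥0∞) ≠ 0 := by
    have : n ≠ 0 := by omega
    exact_mod_cast this
  simp [orbitMeasure, Measure.finsetSum_apply, ENNReal.inv_mul_cancel h (ENNReal.natCast_ne_top n)]

theorem totalWeight_pos [NeZero d] {W : ℕ → Bernoulli d → ℝ} (hW : ∀ n x, 0 < W n x)
    {N : ℕ} (hN : 1 ≤ N) : 0 < totalWeight W N := by
  refine Finset.sum_pos' (fun n _ => Finset.sum_nonneg fun x _ => (hW n x).le)
    ⟨1, Finset.mem_Icc.mpr ⟨le_rfl, hN⟩, ?_⟩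
  refine Finset.sum_pos (fun x _ => hW 1 x) ⟨fun _ => 0, ?_⟩
  rw [mem_fix le_rfl]
  rfl

theorem isProbabilityMeasure_periodicMeasure [NeZero d] {W : ℕ → Bernoulli d → ℝ}
    (hW : ∀ n x, 0 < W n x) {N : ℕ} (hN : 1 ≤ N) :
    IsProbabilityMeasure (periodicMeasure W N) := by
  have hZ := totalWeight_pos hW hN
  constructor
  have h : ∀ n ∈ Finset.Icc 1 N, ∀ x ∈ fix d n,
      (ENNReal.ofReal (W n x / totalWeight W N) • orbitMeasure n x) Set.univ
        = ENNReal.ofReal (W n x / totalWeight W N) := by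
    intro n hn x _
    have := isProbabilityMeasure_orbitMeasure (Finset.mem_Icc.mp hn).1 x
    simp
  have h0 : ∀ n x, 0 ≤ W n x / totalWeight W N := fun n x => (div_pos (hW n x) hZ).le
  simp only [periodicMeasure, Measure.finsetSum_apply]
  rw [Finset.sum_congr rfl fun n hn => Finset.sum_congr rfl (h n hn)]
  rw [Finset.sum_congr rfl fun n _ => (ENNReal.ofReal_sum_of_nonneg fun x _ => h0 n x).symm,
    ← ENNReal.ofReal_sum_of_nonneg fun n _ => Finset.sum_nonneg fun x _ => h0 n x]
  simp only [← Finset.sum_div]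
  rw [show (∑ n ∈ Finset.Icc 1 N, ∑ x ∈ fix d n, W n x) = totalWeight W N from rfl,
    div_self hZ.ne', ENNReal.ofReal_one]

/-- The integrals against `periodicMeasure W N` are the weighted averages
of `k^n (x) / n`. -/
theorem integral_periodicMeasure [NeZero d] {W : ℕ → Bernoulli d → ℝ} (hW : ∀ n x, 0 < W n x)
    {N : ℕ} (hN : 1 ≤ N) (k : Bernoulli d → ℝ) :
    ∫ x, k x ∂(periodicMeasure W N) =
      (∑ n ∈ Finset.Icc 1 N, ∑ x ∈ fix d n, W n x * (birkhoffSum shift k n x / n)) /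
        ∑ n ∈ Finset.Icc 1 N, ∑ x ∈ fix d n, W n x := by
  have hZ := totalWeight_pos hW hN
  have hint : ∀ y : Bernoulli d, Integrable k (Measure.dirac y) := fun y =>
    integrable_dirac (by simp)
  have hio : ∀ n ∈ Finset.Icc 1 N, ∀ x : Bernoulli d, Integrable k (orbitMeasure n x) := by
    intro n hn x
    have hn0 : n ≠ 0 := by have := (Finset.mem_Icc.mp hn).1; omega
    refine Integrable.smul_measure ?_ (by simpa using hn0)
    exact integrable_finsetSum_measure.mpr fun i _ => hint _
  have hiw : ∀ n ∈ Finset.Icc 1 N, ∀ x : Bernoulli d,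
      Integrable k (ENNReal.ofReal (W n x / totalWeight W N) • orbitMeasure n x) :=
    fun n hn x => (hio n hn x).smul_measure ENNReal.ofReal_ne_top
  rw [periodicMeasure, integral_finsetSum_measure
    fun n hn => integrable_finsetSum_measure.mpr fun x _ => hiw n hn x, Finset.sum_div]
  refine Finset.sum_congr rfl fun n hn => ?_
  rw [integral_finsetSum_measure fun x _ => hiw n hn x, Finset.sum_div]
  refine Finset.sum_congr rfl fun x _ => ?_
  rw [integral_smul_measure, orbitMeasure, integral_smul_measure,
    integral_finsetSum_measure fun i _ => hint _,
    ENNReal.toReal_ofReal (div_pos (hW n x) hZ).le]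
  simp only [integral_dirac, birkhoffSum, ENNReal.toReal_inv, ENNReal.toReal_natCast, smul_eq_mul,
    totalWeight]
  ring

/-- `π_{c,N}`, the case of the weights `exp (c f^n (x) - n P(c f))`. -/
def piMeasure [NeZero d] (f : Bernoulli d → ℝ) (c : ℝ) (N : ℕ+) :
    ProbabilityMeasure (Bernoulli d) :=
  ⟨periodicMeasure (fun n x =>
      Real.exp (c * birkhoffSum shift f n x - n * pressure (fun y => c * f y))) N,
    isProbabilityMeasure_periodicMeasure (fun _ _ => Real.exp_pos _) N.pos⟩

/-- `η_{c,N}`, the case of the weights `exp (c f^n (x))`. -/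
def etaMeasure [NeZero d] (f : Bernoulli d → ℝ) (c : ℝ) (N : ℕ+) :
    ProbabilityMeasure (Bernoulli d) :=
  ⟨periodicMeasure (fun n x => Real.exp (c * birkhoffSum shift f n x)) N,
    isProbabilityMeasure_periodicMeasure (fun _ _ => Real.exp_pos _) N.pos⟩

end Bernoulli

end

/-! Both families consist of invariant measures, and the space of probability measures is compact.
So everything follows once `∫ f` along each family tends to `β = beta f`. For that, periodic points
with average below `β - ε` must carry a negligible share of the weight;
`le_integral_periodicMeasure` turns this into the bound on `∫ f`.

There are at most `d ^ n` points in `Fix_n`. For `η` the weights grow with the period, so one good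
point of period `N` suffices: it has `f^N ≥ N β - K` with `K` fixed, and `K ≤ N ε / 2` for large
`N`.

For `π` the factor `exp (-n P(c f))` removes this growth. As `c β ≤ P(c f) ≤ c β + log d`, bad
points weigh at most about `exp (-c ε)` in total, uniformly in `N`. A fixed loss `K` would not beat
this: one needs a periodic orbit, chosen independently of `c` and `N`, with `f^n ≥ n β - δ` and `δ <
ε`. This is `exists_nearly_maximizing_periodic_orbit`, obtained by closing returns and a pigeonhole
on words. -/

namespace Bernoulli

variable {d : ℕ}

/-! ### Continuity and common prefixes. -/

theorem shift_iterate_apply (k : ℕ) (x : Bernoulli d) (m : ℕ) : shift^[k] x m = x (m + k) := by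
  induction k generalizing x m with
  | zero => rfl
  | succ k ih =>
    rw [Function.iterate_succ_apply, ih]
    rfl

theorem continuous_shift : Continuous (shift : Bernoulli d → Bernoulli d) :=
  continuous_pi fun n => continuous_apply (n + 1)

theorem integrable_of_continuous {g : Bernoulli d → ℝ} (hg : Continuous g)
    (ν : Measure (Bernoulli d)) [IsFiniteMeasure ν] : Integrable g ν :=
  (BoundedContinuousFunction.mkOfCompact ⟨g, hg⟩).integrable ν

theorem continuous_integral {g : Bernoulli d → ℝ} (hg : Continuous g) :
    Continuous fun ν : ProbabilityMeasure (Bernoulli d) => ∫ x, g x ∂(ν : Measure (Bernoulli d)) :=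
  continuous_iff_continuousAt.mpr fun _ =>
    ProbabilityMeasure.tendsto_iff_forall_integral_tendsto.mp tendsto_id
      (BoundedContinuousFunction.mkOfCompact ⟨g, hg⟩)

/-- The form in which the Lipschitz hypothesis is used. The given constant may be negative when `d ≤
1`, hence `|C|`. -/
theorem abs_sub_le_of_agree {θ : ℝ} (hθ0 : 0 < θ) (hθ1 : θ < 1) {f : Bernoulli d → ℝ}
    (hf : IsThetaLipschitz θ f) :
    ∃ L : ℝ, 0 ≤ L ∧ ∀ (m : ℕ) (x y : Bernoulli d), (∀ i < m, x i = y i) →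
      |f x - f y| ≤ L * θ ^ m := by
  obtain ⟨C, hC⟩ := hf
  refine ⟨|C|, abs_nonneg C, fun m x y hxy => ?_⟩
  have hD0 : 0 ≤ thetaDist θ x y := by
    unfold thetaDist
    split_ifs <;> positivity
  have hD : thetaDist θ x y ≤ θ ^ m := by
    unfold thetaDist
    split_ifs with h
    · positivity
    · refine pow_le_pow_of_le_one hθ0.le hθ1.le ?_
      by_contra hlt
      exact PiNat.apply_firstDiff_ne h (hxy _ (by omega))
  calc |f x - f y| ≤ C * thetaDist θ x y := hC x y
    _ ≤ |C| * thetaDist θ x y := by gcongr; exact le_abs_self C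
    _ ≤ |C| * θ ^ m := by gcongr

theorem continuous_of_agree {θ : ℝ} (hθ0 : 0 < θ) (hθ1 : θ < 1) {f : Bernoulli d → ℝ} {L : ℝ}
    (hL : ∀ (m : ℕ) (x y : Bernoulli d), (∀ i < m, x i = y i) → |f x - f y| ≤ L * θ ^ m) :
    Continuous f := by
  refine continuous_iff_continuousAt.mpr fun x => Metric.tendsto_nhds.mpr fun ε hε => ?_
  have h0 : Tendsto (fun m : ℕ => L * θ ^ m) atTop (𝓝 0) := by
    simpa using (tendsto_pow_atTop_nhds_zero_of_lt_one hθ0.le hθ1).const_mul L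
  obtain ⟨m, hm⟩ := (h0.eventually_lt_const hε).exists
  filter_upwards [(PiNat.isOpen_cylinder (fun _ : ℕ => Fin d) x m).mem_nhds
    (PiNat.self_mem_cylinder x m)] with y hy
  rw [Real.dist_eq]
  exact (hL m y x fun i hi => hy i hi).trans_lt hm

theorem continuous_birkhoffSum {f : Bernoulli d → ℝ} (hf : Continuous f) (n : ℕ) :
    Continuous (birkhoffSum shift f n) :=
  continuous_finsetSum _ fun i _ => hf.comp (continuous_shift.iterate i)

/-! ### Closing orbit segments. -/

/-- Close returns are shadowed by periodic points. -/
theorem exists_mem_fix_abs_birkhoffSum_sub_le {θ : ℝ} (hθ0 : 0 < θ) (hθ1 : θ < 1)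
    {f : Bernoulli d → ℝ} {L : ℝ} (hL0 : 0 ≤ L)
    (hL : ∀ (m : ℕ) (x y : Bernoulli d), (∀ i < m, x i = y i) → |f x - f y| ≤ L * θ ^ m)
    {m : ℕ} (hm : 1 ≤ m) (k : ℕ) (y : Bernoulli d) (hy : ∀ i < k, y (i + m) = y i) :
    ∃ x ∈ fix d m, |birkhoffSum shift f m x - birkhoffSum shift f m y| ≤ L / (1 - θ) * θ ^ k := by
  refine ⟨fun i => y (i % m), ?_, ?_⟩
  · rw [mem_fix hm]
    funext i
    rw [shift_iterate_apply]
    simp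
  -- The return condition prolongs the agreement from `m` to `m + k` coordinates, so the `i`-th
  -- iterates still share more than `k + (m - 1 - i)` of them and the errors form a geometric
  -- series.
  have hagree : ∀ j < m + k, y (j % m) = y j := by
    intro j
    induction j using Nat.strong_induction_on with
    | _ j ih =>
      intro hj
      by_cases h : j < m
      · rw [Nat.mod_eq_of_lt h]
      · have h1 := ih (j - m) (by omega) (by omega)
        have h2 := hy (j - m) (by omega)
        rw [Nat.sub_add_cancel (by omega)] at h2
        rw [h2, ← h1, ← Nat.mod_eq_sub_mod (by omega)]
  have hgeom : ∑ i ∈ Finset.range m, θ ^ i ≤ 1 / (1 - θ) := by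
    rw [le_div_iff₀ (by linarith), geom_sum_mul_neg]
    linarith [pow_pos hθ0 m]
  calc _ ≤ ∑ i ∈ Finset.range m, |f (shift^[i] fun i => y (i % m)) - f (shift^[i] y)| := by
        rw [birkhoffSum, birkhoffSum, ← Finset.sum_sub_distrib]
        exact Finset.abs_sum_le_sum_abs _ _
    _ ≤ ∑ i ∈ Finset.range m, L * θ ^ k * θ ^ (m - 1 - i) := by
        refine Finset.sum_le_sum fun i hi => ?_
        rw [Finset.mem_range] at hi
        rw [mul_assoc, ← pow_add]
        refine hL _ _ _ fun j hj => ?_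
        rw [shift_iterate_apply, shift_iterate_apply]
        exact hagree _ (by omega)
    _ ≤ L * θ ^ k * (1 / (1 - θ)) := by
        rw [← Finset.mul_sum, Finset.sum_range_reflect (fun i => θ ^ i)]
        gcongr
    _ = _ := by ring

/-! ### Invariant measures. -/

theorem measurePreserving_orbitMeasure {n : ℕ} {x : Bernoulli d} (hx : shift^[n] x = x) :
    MeasurePreserving shift (orbitMeasure n x) (orbitMeasure n x) := by
  refine ⟨continuous_shift.measurable, ?_⟩
  rw [orbitMeasure, Measure.map_smul]
  congr 1
  rw [← Measure.mapₗ_apply_of_measurable continuous_shift.measurable, map_sum]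
  simp only [Measure.mapₗ_apply_of_measurable continuous_shift.measurable,
    Measure.map_dirac' continuous_shift.measurable, ← Function.iterate_succ_apply' shift]
  -- The sum of `n + 1` Dirac masses is split off at either end. The two end masses coincide by
  -- periodicity and cancel set by set, where they are finite.
  have h1 := Finset.sum_range_succ (fun i => Measure.dirac (shift^[i] x)) n
  rw [Finset.sum_range_succ', hx, Function.iterate_zero, id] at h1
  refine Measure.ext fun s hs => ?_
  have h2 := congrArg (fun μ : Measure (Bernoulli d) => μ s) h1
  simp only [Measure.add_apply] at h2
  exact (ENNReal.add_left_inj (measure_ne_top _ s)).mp h2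

theorem measurePreserving_periodicMeasure (W : ℕ → Bernoulli d → ℝ) (N : ℕ) :
    MeasurePreserving shift (periodicMeasure W N) (periodicMeasure W N) := by
  refine ⟨continuous_shift.measurable, ?_⟩
  rw [periodicMeasure, ← Measure.mapₗ_apply_of_measurable continuous_shift.measurable, map_sum]
  refine Finset.sum_congr rfl fun n hn => ?_
  rw [map_sum]
  refine Finset.sum_congr rfl fun x hx => ?_
  rw [Measure.mapₗ_apply_of_measurable continuous_shift.measurable, Measure.map_smul,
    (measurePreserving_orbitMeasure ((mem_fix (Finset.mem_Icc.mp hn).1 x).mp hx)).map_eq]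

theorem isClosed_invariantMeasures : IsClosed (invariantMeasures d) := by
  have h : invariantMeasures d =
      {ν | ν.map (continuous_shift (d := d)).measurable.aemeasurable = ν} := by
    ext ν
    constructor
    · intro hν
      exact Subtype.ext hν.map_eq
    · intro hν
      exact ⟨continuous_shift.measurable, congrArg Subtype.val hν⟩
  rw [h]
  exact isClosed_eq (ProbabilityMeasure.continuous_map continuous_shift) continuous_id

theorem integral_birkhoffSum {f : Bernoulli d → ℝ} (hf : Continuous f)
    {ν : ProbabilityMeasure (Bernoulli d)} (hν : ν ∈ invariantMeasures d) (n : ℕ) :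
    ∫ x, birkhoffSum shift f n x ∂(ν : Measure (Bernoulli d)) =
      n * ∫ x, f x ∂(ν : Measure (Bernoulli d)) := by
  have hν' : MeasurePreserving shift (ν : Measure (Bernoulli d)) (ν : Measure (Bernoulli d)) := hν
  have h : ∀ i, ∫ x, f (shift^[i] x) ∂(ν : Measure (Bernoulli d)) =
      ∫ x, f x ∂(ν : Measure (Bernoulli d)) := by
    intro i
    rw [← integral_map (φ := shift^[i]) (f := f) (hν'.iterate i).measurable.aemeasurable
      hf.measurable.aestronglyMeasurable, (hν'.iterate i).map_eq]
  simp only [birkhoffSum]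
  have hint : ∀ i, Integrable (fun x => f (shift^[i] x)) (ν : Measure (Bernoulli d)) := fun i =>
    integrable_of_continuous (hf.comp (continuous_shift.iterate i)) _
  rw [integral_finsetSum _ fun i _ => hint i]
  simp [h]

theorem integral_orbitMeasure (f : Bernoulli d → ℝ) (n : ℕ) (x : Bernoulli d) :
    ∫ y, f y ∂(orbitMeasure n x) = birkhoffSum shift f n x / n := by
  rw [orbitMeasure, integral_smul_measure,
    integral_finsetSum_measure fun i _ => integrable_dirac (by simp)]
  simp [birkhoffSum, div_eq_inv_mul]

/-! ### Birkhoff sums against `n * beta f`. -/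

theorem integral_le_beta {f : Bernoulli d → ℝ} (hf : Continuous f)
    {ν : ProbabilityMeasure (Bernoulli d)} (hν : ν ∈ invariantMeasures d) :
    ∫ x, f x ∂(ν : Measure (Bernoulli d)) ≤ beta f := by
  refine le_csSup ?_ ⟨ν, hν, rfl⟩
  exact ((isCompact_range (continuous_integral hf)).bddAbove).mono (Set.image_subset_range _ _)

theorem birkhoffSum_le_of_mem_fix {f : Bernoulli d → ℝ} (hf : Continuous f) {n : ℕ} (hn : 1 ≤ n)
    {x : Bernoulli d} (hx : x ∈ fix d n) : birkhoffSum shift f n x ≤ n * beta f := by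
  have h := integral_le_beta hf (ν := ⟨orbitMeasure n x, isProbabilityMeasure_orbitMeasure hn x⟩)
    (measurePreserving_orbitMeasure ((mem_fix hn x).mp hx))
  have hn' : (0 : ℝ) < n := by exact_mod_cast hn
  rw [ProbabilityMeasure.coe_mk, integral_orbitMeasure, div_le_iff₀ hn'] at h
  linarith

theorem invariantMeasures_nonempty [NeZero d] : (invariantMeasures d).Nonempty :=
  ⟨⟨orbitMeasure 1 fun _ => 0, isProbabilityMeasure_orbitMeasure le_rfl _⟩,
    measurePreserving_orbitMeasure rfl⟩

/-- Otherwise integrating `f^n ≤ n β - 1` against invariant measures would give `β ≤ β - 1 / n`. -/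
theorem exists_birkhoffSum_gt [NeZero d] {f : Bernoulli d → ℝ} (hf : Continuous f) {n : ℕ}
    (hn : 1 ≤ n) : ∃ y, n * beta f - 1 < birkhoffSum shift f n y := by
  by_contra! h
  have hn' : (0 : ℝ) < n := by exact_mod_cast hn
  have : beta f ≤ beta f - 1 / n := by
    refine csSup_le (invariantMeasures_nonempty.image _) ?_
    rintro _ ⟨ν, hν, rfl⟩
    have h1 := integral_mono (integrable_of_continuous (continuous_birkhoffSum hf n)
      (ν : Measure (Bernoulli d))) (integrable_const _) h
    rw [integral_birkhoffSum hf hν] at h1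
    simp only [integral_const, probReal_univ, smul_eq_mul, one_mul] at h1
    rw [← sub_nonneg]
    have : beta f - 1 / n - ∫ x, f x ∂(ν : Measure (Bernoulli d)) =
      (n * beta f - 1 - n * ∫ x, f x ∂(ν : Measure (Bernoulli d))) / n := by field_simp
    rw [this]
    exact div_nonneg (by linarith) hn'.le
  have : 0 < 1 / (n : ℝ) := by positivity
  linarith

/-- Any segment closes up with `k = 0`, at a cost of `L / (1 - θ)`, and periodic sums never exceed
`n β`. -/
theorem birkhoffSum_le_mul_beta_add {θ : ℝ} (hθ0 : 0 < θ) (hθ1 : θ < 1)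
    {f : Bernoulli d → ℝ} {L : ℝ} (hL0 : 0 ≤ L)
    (hL : ∀ (m : ℕ) (x y : Bernoulli d), (∀ i < m, x i = y i) → |f x - f y| ≤ L * θ ^ m)
    (n : ℕ) (y : Bernoulli d) : birkhoffSum shift f n y ≤ n * beta f + L / (1 - θ) := by
  rcases Nat.eq_zero_or_pos n with rfl | hn
  · have : 0 ≤ L / (1 - θ) := div_nonneg hL0 (by linarith)
    simpa using this
  obtain ⟨x, hx, hxy⟩ := exists_mem_fix_abs_birkhoffSum_sub_le hθ0 hθ1 hL0 hL hn 0 y (by simp)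
  have := birkhoffSum_le_of_mem_fix (continuous_of_agree hθ0 hθ1 hL) hn hx
  rw [pow_zero, mul_one] at hxy
  linarith [(abs_le.mp hxy).1]

theorem exists_mem_fix_birkhoffSum_ge [NeZero d] {θ : ℝ} (hθ0 : 0 < θ) (hθ1 : θ < 1)
    {f : Bernoulli d → ℝ} {L : ℝ} (hL0 : 0 ≤ L)
    (hL : ∀ (m : ℕ) (x y : Bernoulli d), (∀ i < m, x i = y i) → |f x - f y| ≤ L * θ ^ m)
    {n : ℕ} (hn : 1 ≤ n) :
    ∃ x ∈ fix d n, n * beta f - (1 + L / (1 - θ)) ≤ birkhoffSum shift f n x := by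
  obtain ⟨y, hy⟩ := exists_birkhoffSum_gt (continuous_of_agree hθ0 hθ1 hL) hn
  obtain ⟨x, hx, hxy⟩ := exists_mem_fix_abs_birkhoffSum_sub_le hθ0 hθ1 hL0 hL hn 0 y (by simp)
  rw [pow_zero, mul_one] at hxy
  exact ⟨x, hx, by linarith [(abs_le.mp hxy).1]⟩

/-- Some periodic orbit has a Birkhoff sum as close as desired to the largest conceivable one. -/
theorem exists_nearly_maximizing_periodic_orbit [NeZero d] {θ : ℝ} (hθ0 : 0 < θ) (hθ1 : θ < 1)
    {f : Bernoulli d → ℝ} {L : ℝ} (hL0 : 0 ≤ L)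
    (hL : ∀ (m : ℕ) (x y : Bernoulli d), (∀ i < m, x i = y i) → |f x - f y| ≤ L * θ ^ m)
    {δ : ℝ} (hδ : 0 < δ) :
    ∃ n : ℕ, 1 ≤ n ∧ ∃ x ∈ fix d n, n * beta f - δ ≤ birkhoffSum shift f n x := by
  by_contra! h
  set K := L / (1 - θ) with hK
  obtain ⟨k, hk⟩ : ∃ k : ℕ, K * θ ^ k < δ / 2 := by
    have h0 : Tendsto (fun m : ℕ => K * θ ^ m) atTop (𝓝 0) := by
      simpa using (tendsto_pow_atTop_nhds_zero_of_lt_one hθ0.le hθ1).const_mul K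
    exact (h0.eventually_lt_const (half_pos hδ)).exists
  have hbound : ∀ n y, birkhoffSum shift f n y ≤ n * beta f + K :=
    birkhoffSum_le_mul_beta_add hθ0 hθ1 hL0 hL
  -- If every periodic orbit loses more than `δ`, then a return to the same `k`-word loses at least
  -- `δ / 2`, since closing it costs less than `δ / 2`.
  have hloop : ∀ (m : ℕ) (y : Bernoulli d), 1 ≤ m → (∀ i < k, y (i + m) = y i) →
      birkhoffSum shift f m y ≤ m * beta f - δ / 2 := by
    intro m y hm hy
    obtain ⟨x, hx, hxy⟩ := exists_mem_fix_abs_birkhoffSum_sub_le hθ0 hθ1 hL0 hL hm k y hy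
    linarith [(abs_le.mp hxy).1, h m hm x hx]
  -- Cut at the visits to `w`: the initial piece gains at most `K`, and each loop between
  -- consecutive visits loses `δ / 2`. `T` holds the visits before the last one, `i`.
  have hvisits : ∀ (y : Bernoulli d) (w : Fin k → Fin d) (T : Finset ℕ),
      (∀ j ∈ T, ∀ a : Fin k, y (a + j) = w a) → ∀ i, (∀ j ∈ T, j < i) →
      (∀ a : Fin k, y (a + i) = w a) →
      birkhoffSum shift f i y ≤ i * beta f + K - δ / 2 * T.card := by
    intro y w T
    induction T using Finset.induction_on_max with
    | empty => intro _ i _ _; simpa using hbound i y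
    | insert j T hj ih =>
      intro hw i hi hwi
      have h1 := ih (fun l hl => hw l (Finset.mem_insert_of_mem hl)) j hj
        (hw j (Finset.mem_insert_self _ _))
      have hji := hi j (Finset.mem_insert_self _ _)
      have h2 := hloop (i - j) (shift^[j] y) (by omega) fun a ha => by
        rw [shift_iterate_apply, shift_iterate_apply, hw j (Finset.mem_insert_self _ _) ⟨a, ha⟩,
          ← hwi ⟨a, ha⟩]
        congr 1
        simp only
        omega
      have h3 := birkhoffSum_add shift f j (i - j) y
      rw [Nat.add_sub_cancel' hji.le] at h3
      have hjT : j ∉ T := fun hmem => lt_irrefl _ (hj j hmem)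
      rw [Finset.card_insert_of_notMem hjT, h3]
      push_cast [Nat.cast_sub hji.le] at h2 ⊢
      linarith
  -- Among `d ^ k * (v + 1)` times some `k`-word occurs `v + 1` times, giving `v` loops. Their loss
  -- outweighs the gain `2 * K` of the two end pieces plus the slack `1` in the choice of `y`.
  obtain ⟨v, hv⟩ := exists_nat_gt ((2 * K + 1) / (δ / 2))
  rw [div_lt_iff₀ (half_pos hδ)] at hv
  have hd : 0 < d := Nat.pos_of_ne_zero (NeZero.ne d)
  have hn : 1 ≤ d ^ k * (v + 1) := Nat.mul_pos (pow_pos hd k) (Nat.succ_pos v)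
  obtain ⟨y, hy⟩ := exists_birkhoffSum_gt (continuous_of_agree hθ0 hθ1 hL) hn
  obtain ⟨w, -, hw⟩ := Finset.exists_le_card_fiber_of_mul_le_card_of_maps_to
    (s := Finset.range (d ^ k * (v + 1))) (t := (Finset.univ : Finset (Fin k → Fin d)))
    (f := fun j a => y (a + j)) (n := v + 1) (fun _ _ => Finset.mem_univ _)
    Finset.univ_nonempty (by simp)
  set T := {j ∈ Finset.range (d ^ k * (v + 1)) | (fun a : Fin k => y (a + j)) = w} with hT
  have hTne : T.Nonempty := Finset.card_pos.mp (by omega)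
  set i := T.max' hTne with hi
  have hiT : i ∈ T := T.max'_mem hTne
  have hTw : ∀ j ∈ T, ∀ a : Fin k, y (a + j) = w a := fun j hj a =>
    congrFun (Finset.mem_filter.mp hj).2 a
  have h1 := hvisits y w (T.erase i) (fun j hj => hTw j (Finset.mem_of_mem_erase hj)) i
    (fun j hj => lt_of_le_of_ne (T.le_max' j (Finset.mem_of_mem_erase hj)) (Finset.ne_of_mem_erase hj))
    (hTw i hiT)
  have hin : i < d ^ k * (v + 1) := Finset.mem_range.mp (Finset.mem_filter.mp hiT).1
  have h2 := hbound (d ^ k * (v + 1) - i) (shift^[i] y)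
  have h3 := birkhoffSum_add shift f i (d ^ k * (v + 1) - i) y
  rw [Nat.add_sub_cancel' hin.le] at h3
  have h4 : (v : ℝ) ≤ (T.erase i).card := by
    rw [Finset.card_erase_of_mem hiT]
    exact_mod_cast (by omega : v ≤ T.card - 1)
  have h5 : δ / 2 * v ≤ δ / 2 * (T.erase i).card := by gcongr
  rw [Nat.cast_sub hin.le] at h2
  linarith

/-! ### Counting periodic points and bounding the pressure. -/

theorem card_fix_le {n : ℕ} (hn : 1 ≤ n) : (fix d n).card ≤ d ^ n := by
  have h := Finset.card_le_card_of_injOn (s := fix d n)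
    (t := (Finset.univ : Finset (Fin n → Fin d))) (fun x i => x i)
    (fun _ _ => Finset.mem_coe.mpr (Finset.mem_univ _)) ?_
  · simpa using h
  have hper : ∀ x ∈ fix d n, ∀ m, x (m % n) = x m := by
    intro x hx m
    refine Function.Periodic.map_mod_nat (f := x) (fun j => ?_) m
    rw [← shift_iterate_apply n x j, (mem_fix hn x).mp hx]
  intro x hx y hy hxy
  funext m
  rw [← hper x hx m, ← hper y hy m]
  exact congrFun hxy ⟨m % n, Nat.mod_lt _ hn⟩

theorem birkhoffSum_const_mul (c : ℝ) (f : Bernoulli d → ℝ) (n : ℕ) (x : Bernoulli d) :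
    birkhoffSum shift (fun y => c * f y) n x = c * birkhoffSum shift f n x := by
  simp only [birkhoffSum, Finset.mul_sum]

theorem partitionFunction_le {f : Bernoulli d → ℝ} {K : ℝ}
    (hK : ∀ n y, birkhoffSum shift f n y ≤ n * beta f + K) {c : ℝ} (hc : 0 ≤ c)
    (n : ℕ) :
    partitionFunction (fun y => c * f y) n ≤ d ^ n * Real.exp (c * (n * beta f + K)) := by
  have h : ∀ w ∈ (Finset.univ : Finset (Fin n → Fin d)),
      sSup ((fun x => Real.exp (birkhoffSum shift (fun y => c * f y) n x)) '' cylinder w) ≤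
        Real.exp (c * (n * beta f + K)) := by
    intro w _
    refine Real.sSup_le ?_ (Real.exp_pos _).le
    rintro _ ⟨x, -, rfl⟩
    simp only [birkhoffSum_const_mul]
    gcongr
    exact hK n x
  refine (Finset.sum_le_card_nsmul _ _ _ h).trans_eq ?_
  simp

theorem le_partitionFunction [NeZero d] {f : Bernoulli d → ℝ} {K : ℝ}
    (hK : ∀ n y, birkhoffSum shift f n y ≤ n * beta f + K) {c : ℝ} (hc : 0 ≤ c)
    (hf : Continuous f) {n : ℕ} (hn : 1 ≤ n) :
    Real.exp (c * (n * beta f - 1)) ≤ partitionFunction (fun y => c * f y) n := by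
  obtain ⟨y, hy⟩ := exists_birkhoffSum_gt hf hn
  have hnonneg : ∀ w ∈ (Finset.univ : Finset (Fin n → Fin d)), 0 ≤
      sSup ((fun x => Real.exp (birkhoffSum shift (fun y => c * f y) n x)) '' cylinder w) := by
    intro w _
    refine Real.sSup_nonneg ?_
    rintro _ ⟨x, -, rfl⟩
    exact (Real.exp_pos _).le
  refine le_trans ?_ (Finset.single_le_sum hnonneg (Finset.mem_univ fun i : Fin n => y i))
  -- The upper bound `hK` is needed even here: the supremum of an unbounded set of reals is `0` by
  -- convention.
  refine le_trans ?_ (le_csSup ⟨Real.exp (c * (n * beta f + K)), ?_⟩ ⟨y, fun _ => rfl, rfl⟩)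
  · simp only [birkhoffSum_const_mul]
    gcongr
  · rintro _ ⟨x, -, rfl⟩
    simp only [birkhoffSum_const_mul]
    gcongr
    exact hK n x

theorem pressure_mem_Icc [NeZero d] {f : Bernoulli d → ℝ} {K : ℝ}
    (hK : ∀ n y, birkhoffSum shift f n y ≤ n * beta f + K) {c : ℝ} (hc : 0 ≤ c)
    (hf : Continuous f) :
    pressure (fun y => c * f y) ∈ Set.Icc (c * beta f) (c * beta f + Real.log d) := by
  have hd : (0 : ℝ) < d := by exact_mod_cast Nat.pos_of_ne_zero (NeZero.ne d)
  have hlow : ∀ᶠ n : ℕ in atTop, c * beta f - c / n ≤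
      Real.log (partitionFunction (fun y => c * f y) n) / n := by
    filter_upwards [eventually_ge_atTop 1] with n hn
    have hn' : (0 : ℝ) < n := by exact_mod_cast hn
    have h := Real.log_le_log (Real.exp_pos _) (le_partitionFunction hK hc hf hn)
    rw [Real.log_exp] at h
    rw [le_div_iff₀ hn']
    refine le_trans (le_of_eq ?_) h
    field_simp
  have hupp : ∀ᶠ n : ℕ in atTop, Real.log (partitionFunction (fun y => c * f y) n) / n ≤
      c * beta f + Real.log d + c * K / n := by
    filter_upwards [eventually_ge_atTop 1] with n hn
    have hn' : (0 : ℝ) < n := by exact_mod_cast hn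
    have h := Real.log_le_log ((Real.exp_pos _).trans_le (le_partitionFunction hK hc hf hn))
      (partitionFunction_le hK hc n)
    rw [Real.log_mul (by positivity) (Real.exp_pos _).ne', Real.log_exp, Real.log_pow] at h
    rw [div_le_iff₀ hn']
    refine h.trans (le_of_eq ?_)
    field_simp
    ring
  have htl : Tendsto (fun n : ℕ => c * beta f - c / n) atTop (𝓝 (c * beta f)) := by
    simpa using tendsto_const_nhds.sub (tendsto_const_div_atTop_nhds_zero_nat c)
  have htu : Tendsto (fun n : ℕ => c * beta f + Real.log d + c * K / n) atTop
      (𝓝 (c * beta f + Real.log d)) := by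
    simpa using tendsto_const_nhds.add (tendsto_const_div_atTop_nhds_zero_nat (c * K))
  -- A real `limsup` is meaningful only for bounded sequences; the two estimates supply this as
  -- well.
  have hba := htu.isBoundedUnder_le.mono_le hupp
  have hbb := htl.isBoundedUnder_ge.mono_ge hlow
  constructor
  · rw [← htl.limsup_eq]
    exact limsup_le_limsup hlow htl.isBoundedUnder_ge.isCoboundedUnder_le hba
  · rw [← htu.limsup_eq]
    exact limsup_le_limsup hupp hbb.isCoboundedUnder_le htu.isBoundedUnder_le

/-! ### Low averages carry little weight. -/

theorem le_totalWeight {W : ℕ → Bernoulli d → ℝ} (hW : ∀ n x, 0 < W n x) {N n : ℕ} (hn : 1 ≤ n)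
    (hnN : n ≤ N) {x : Bernoulli d} (hx : x ∈ fix d n) : W n x ≤ totalWeight W N :=
  (Finset.single_le_sum (f := W n) (fun x _ => (hW n x).le) hx).trans <|
    Finset.single_le_sum (f := fun n => ∑ x ∈ fix d n, W n x)
      (fun n _ => Finset.sum_nonneg fun x _ => (hW n x).le) (Finset.mem_Icc.mpr ⟨hn, hnN⟩)

/-- If the periodic points whose averages are less than `β(f) - ε` carry little of the total
weight, then the weighted average is close to `β(f)`. -/
theorem le_integral_periodicMeasure [NeZero d] {f : Bernoulli d → ℝ} (hpos : ∀ x, 0 < f x)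
    (hβ : 0 ≤ beta f) {W : ℕ → Bernoulli d → ℝ} (hW : ∀ n x, 0 < W n x) {N : ℕ} (hN : 1 ≤ N)
    {ε z : ℝ} (hε : 0 ≤ ε) {b : ℕ → ℝ} (hb0 : ∀ n, 0 ≤ b n)
    (hb : ∀ n ∈ Finset.Icc 1 N, ∀ x, birkhoffSum shift f n x < n * (beta f - ε) → W n x ≤ b n)
    (hz : z ≤ totalWeight W N) (hsum : ∑ n ∈ Finset.Icc 1 N, d ^ n * b n ≤ ε * z) :
    beta f - ε - beta f * ε ≤ ∫ x, f x ∂(periodicMeasure W N) := by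
  have hZ := totalWeight_pos hW hN
  have hdef : ∑ n ∈ Finset.Icc 1 N, ∑ x ∈ fix d n, W n x = totalWeight W N := rfl
  rw [integral_periodicMeasure hW hN, hdef, le_div_iff₀ hZ]
  have hpt : ∀ n ∈ Finset.Icc 1 N, ∀ x ∈ fix d n,
      (beta f - ε) * W n x ≤ W n x * (birkhoffSum shift f n x / n) + beta f * b n := by
    intro n hn x _
    have hn' : (0 : ℝ) < n := by exact_mod_cast (Finset.mem_Icc.mp hn).1
    have hw := hW n x
    by_cases h : birkhoffSum shift f n x < n * (beta f - ε)
    -- At a low point the average is still nonnegative, as `f > 0`, so the deficit is at most `β * W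
    -- ≤ β * b`.
    · have h1 := hb n hn x h
      have h2 : 0 ≤ birkhoffSum shift f n x / n :=
        div_nonneg (Finset.sum_nonneg fun i _ => (hpos _).le) hn'.le
      have h3 : 0 ≤ W n x * (birkhoffSum shift f n x / n) := by positivity
      have h4 : beta f * W n x ≤ beta f * b n := by gcongr
      have h5 : 0 ≤ ε * W n x := by positivity
      linarith
    · have h1 : beta f - ε ≤ birkhoffSum shift f n x / n := by
        rw [le_div_iff₀ hn']
        linarith
      have h2 : W n x * (beta f - ε) ≤ W n x * (birkhoffSum shift f n x / n) := by gcongr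
      have h3 : 0 ≤ beta f * b n := mul_nonneg hβ (hb0 n)
      linarith
  have hsum1 := Finset.sum_le_sum fun n hn => Finset.sum_le_sum (hpt n hn)
  simp only [Finset.sum_add_distrib, ← Finset.mul_sum, Finset.sum_const, nsmul_eq_mul] at hsum1
  have hcard : beta f * ∑ n ∈ Finset.Icc 1 N, (fix d n).card * b n ≤
      beta f * ∑ n ∈ Finset.Icc 1 N, d ^ n * b n := by
    gcongr with n hn
    · exact hb0 n
    · exact_mod_cast card_fix_le (Finset.mem_Icc.mp hn).1
  have hfin : beta f * ∑ n ∈ Finset.Icc 1 N, d ^ n * b n ≤ beta f * (ε * totalWeight W N) := by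
    gcongr
    exact hsum.trans (by gcongr)
  rw [hdef] at hsum1
  linarith

theorem sum_Icc_pow_le {r : ℝ} (hr0 : 0 ≤ r) (hr : r ≤ 1 / 2) (N : ℕ) :
    ∑ n ∈ Finset.Icc 1 N, r ^ n ≤ 2 * r := by
  -- Strengthened so that the induction closes.
  have h : ∑ n ∈ Finset.Icc 1 N, r ^ n ≤ 2 * r - 2 * r ^ (N + 1) := by
    induction N with
    | zero => simp
    | succ N ih =>
      rw [Finset.sum_Icc_succ_top (by omega)]
      have h1 : r ^ (N + 1 + 1) ≤ r ^ (N + 1) * (1 / 2) := by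
        rw [pow_succ]
        gcongr
      linarith
  have : 0 ≤ r ^ (N + 1) := by positivity
  linarith

theorem eventually_exp_neg_mul_le {a r : ℝ} (ha : 0 < a) (hr : 0 < r) :
    ∀ᶠ c : ℝ in atTop, Real.exp (-(c * a)) ≤ r := by
  have h : Tendsto (fun c : ℝ => Real.exp (-(c * a))) atTop (𝓝 0) :=
    Real.tendsto_exp_neg_atTop_nhds_zero.comp (tendsto_id.atTop_mul_const ha)
  exact h.eventually_le_const hr

theorem eventually_le_integral_piMeasure [NeZero d] {θ : ℝ} (hθ0 : 0 < θ) (hθ1 : θ < 1)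
    {f : Bernoulli d → ℝ} {L : ℝ} (hL0 : 0 ≤ L)
    (hL : ∀ (m : ℕ) (x y : Bernoulli d), (∀ i < m, x i = y i) → |f x - f y| ≤ L * θ ^ m)
    (hpos : ∀ x, 0 < f x) (hβ : 0 ≤ beta f) {ε : ℝ} (hε : 0 < ε) :
    ∀ᶠ p : ℝ × ℕ+ in atTop ×ˢ atTop, beta f - ε - beta f * ε ≤
      ∫ x, f x ∂(piMeasure f p.1 p.2 : Measure (Bernoulli d)) := by
  have hd : (0 : ℝ) < d := by exact_mod_cast Nat.pos_of_ne_zero (NeZero.ne d)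
  obtain ⟨n₀, hn₀, x₀, hx₀, hfx₀⟩ :=
    exists_nearly_maximizing_periodic_orbit hθ0 hθ1 hL0 hL (half_pos hε)
  -- The first bound makes the ratio `d * exp (-c ε)` at most `1 / 2`; the second gives `2 * d * exp
  -- (-c ε) ≤ ε * z`, where `z` is the lower bound for the weight of `x₀`.
  have hC := (eventually_exp_neg_mul_le hε (r := 1 / (2 * d)) (by positivity)).and <|
    (eventually_exp_neg_mul_le (half_pos hε) (r := ε / (2 * d * d ^ n₀)) (by positivity)).and
      (eventually_ge_atTop (0 : ℝ))
  filter_upwards [hC.prod_mk (eventually_ge_atTop (⟨n₀, hn₀⟩ : ℕ+))]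
  rintro ⟨c, N⟩ ⟨⟨hc1, hc2, hc⟩, hN⟩
  simp only at hc1 hc2 hc hN
  obtain ⟨hP1, hP2⟩ := pressure_mem_Icc (birkhoffSum_le_mul_beta_add hθ0 hθ1 hL0 hL) hc
    (continuous_of_agree hθ0 hθ1 hL)
  refine le_integral_periodicMeasure hpos hβ (fun _ _ => Real.exp_pos _) N.pos hε.le
    (b := fun n => Real.exp (-(c * ε)) ^ n) (z := Real.exp (-(c * (ε / 2))) / d ^ n₀)
    (fun n => by positivity) ?_ (le_trans ?_ (le_totalWeight (fun _ _ => Real.exp_pos _) hn₀ hN hx₀))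
    ?_
  · intro n hn x hx
    rw [← Real.exp_nat_mul, Real.exp_le_exp]
    have h1 := mul_le_mul_of_nonneg_left hx.le hc
    have h2 := mul_le_mul_of_nonneg_left hP1 n.cast_nonneg
    linarith
  · have h : (d : ℝ) ^ n₀ = Real.exp (n₀ * Real.log d) := by
      rw [Real.exp_nat_mul, Real.exp_log hd]
    rw [h, ← Real.exp_sub, Real.exp_le_exp]
    have h1 := mul_le_mul_of_nonneg_left hfx₀ hc
    have h2 := mul_le_mul_of_nonneg_left hP2 n₀.cast_nonneg
    linarith
  · simp only [← mul_pow]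
    refine (sum_Icc_pow_le (by positivity) ?_ _).trans ?_
    · rw [le_div_iff₀ (by positivity)] at hc1
      linarith
    · have h : Real.exp (-(c * ε)) = Real.exp (-(c * (ε / 2))) * Real.exp (-(c * (ε / 2))) := by
        rw [← Real.exp_add]
        ring_nf
      have h2 : Real.exp (-(c * (ε / 2))) * (2 * d) ≤ ε / d ^ n₀ := by
        rw [le_div_iff₀ (by positivity)] at hc2 ⊢
        linarith
      have h3 := mul_le_mul_of_nonneg_left h2 (Real.exp_pos (-(c * (ε / 2)))).le
      rw [h]
      calc _ = Real.exp (-(c * (ε / 2))) * (Real.exp (-(c * (ε / 2))) * (2 * d)) := by ring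
        _ ≤ _ := h3
        _ = _ := by ring

theorem eventually_le_integral_etaMeasure [NeZero d] {θ : ℝ} (hθ0 : 0 < θ) (hθ1 : θ < 1)
    {f : Bernoulli d → ℝ} {L : ℝ} (hL0 : 0 ≤ L)
    (hL : ∀ (m : ℕ) (x y : Bernoulli d), (∀ i < m, x i = y i) → |f x - f y| ≤ L * θ ^ m)
    (hpos : ∀ x, 0 < f x) {ε : ℝ} (hε : 0 < ε) (hεβ : ε < beta f) :
    ∀ᶠ p : ℝ × ℕ+ in atTop ×ˢ atTop, beta f - ε - beta f * ε ≤
      ∫ x, f x ∂(etaMeasure f p.1 p.2 : Measure (Bernoulli d)) := by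
  have hd : (1 : ℝ) ≤ d := by exact_mod_cast Nat.pos_of_ne_zero (NeZero.ne d)
  have hd0 : (0 : ℝ) < d := by linarith
  set K := 1 + L / (1 - θ) with hK
  obtain ⟨N₀, hN₀⟩ := exists_nat_gt (K / (ε / 2))
  rw [div_lt_iff₀ (half_pos hε)] at hN₀
  have hC := (eventually_exp_neg_mul_le (half_pos hε) (r := min ε 1 / (2 * d))
    (by positivity)).and (eventually_ge_atTop (0 : ℝ))
  filter_upwards [hC.prod_mk (eventually_ge_atTop (N₀.succPNat))]
  rintro ⟨c, N⟩ ⟨⟨hc1, hc⟩, hN⟩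
  simp only at hc1 hc hN
  have hNN : N₀ ≤ (N : ℕ) := by
    have : (N₀.succPNat : ℕ) ≤ N := hN
    rw [Nat.succPNat_coe] at this
    omega
  have hNK : K ≤ N * (ε / 2) := hN₀.le.trans (by gcongr)
  obtain ⟨x, hx, hfx⟩ := exists_mem_fix_birkhoffSum_ge hθ0 hθ1 hL0 hL N.pos
  refine le_integral_periodicMeasure hpos (by linarith) (fun _ _ => Real.exp_pos _) N.pos hε.le
    (b := fun n => Real.exp (c * (n * (beta f - ε)))) (z := Real.exp (c * (N * beta f - K)))
    (fun n => (Real.exp_pos _).le) ?_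
    (le_trans ?_ (le_totalWeight (fun _ _ => Real.exp_pos _) N.pos le_rfl hx)) ?_
  · intro n _ x hx
    gcongr
  · gcongr
  -- As `ε < β` and `d ≥ 1`, the bounds increase with `n`, so `N` copies of the last one suffice.
  -- The factor `N ≤ 2 ^ N` is absorbed in the power.
  · have hterm : ∀ n ∈ Finset.Icc 1 (N : ℕ), (d : ℝ) ^ n * Real.exp (c * (n * (beta f - ε))) ≤
        (d : ℝ) ^ (N : ℕ) * Real.exp (c * (N * (beta f - ε))) := by
      intro n hn
      have hnN := (Finset.mem_Icc.mp hn).2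
      have : 0 ≤ beta f - ε := by linarith
      gcongr
    refine (Finset.sum_le_card_nsmul _ _ _ hterm).trans ?_
    rw [Nat.card_Icc, Nat.add_sub_cancel, nsmul_eq_mul]
    have h2N : ((N : ℕ) : ℝ) ≤ 2 ^ (N : ℕ) := by exact_mod_cast Nat.lt_two_pow_self.le
    have hexp : Real.exp (c * (N * (beta f - ε))) ≤
        Real.exp (-(c * (ε / 2))) ^ (N : ℕ) * Real.exp (c * (N * beta f - K)) := by
      rw [← Real.exp_nat_mul, ← Real.exp_add, Real.exp_le_exp]
      have := mul_le_mul_of_nonneg_left hNK hc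
      linarith
    rw [le_div_iff₀ (by positivity)] at hc1
    have hr : (2 * (d * Real.exp (-(c * (ε / 2))))) ^ (N : ℕ) ≤ ε := by
      refine (pow_le_of_le_one (by positivity) ?_ N.ne_zero).trans ?_
      · linarith [min_le_right ε 1]
      · linarith [min_le_left ε 1]
    calc _ ≤ 2 ^ (N : ℕ) * ((d : ℝ) ^ (N : ℕ) * (Real.exp (-(c * (ε / 2))) ^ (N : ℕ) *
          Real.exp (c * (N * beta f - K)))) := by gcongr
      _ = (2 * (d * Real.exp (-(c * (ε / 2))))) ^ (N : ℕ) * Real.exp (c * (N * beta f - K)) := by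
        rw [mul_pow, mul_pow]; ring
      _ ≤ _ := by gcongr

/-! ### Compactness and accumulation points. -/

theorem beta_pos [NeZero d] {f : Bernoulli d → ℝ} (hf : Continuous f) (hpos : ∀ x, 0 < f x) :
    0 < beta f := by
  have h := birkhoffSum_le_of_mem_fix hf le_rfl ((mem_fix le_rfl fun _ : ℕ => (0 : Fin d)).mpr rfl)
  rw [birkhoffSum_one, Nat.cast_one, one_mul] at h
  exact (hpos _).trans_le h

theorem exists_error_le {B a : ℝ} (hB : 0 < B) (ha : a < B) :
    ∃ ε : ℝ, 0 < ε ∧ ε < B ∧ a ≤ B - ε - B * ε := by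
  refine ⟨min (B / 2) ((B - a) / (1 + B)),
    lt_min (by linarith) (div_pos (by linarith) (by linarith)),
    (min_le_left _ _).trans_lt (by linarith), ?_⟩
  have h := min_le_right (B / 2) ((B - a) / (1 + B))
  rw [le_div_iff₀ (by linarith)] at h
  linarith

section ClusterPoints

variable {f : Bernoulli d → ℝ} {ι : Type*} {F : Filter ι}
  {u : ι → ProbabilityMeasure (Bernoulli d)}

theorem mem_maximizingMeasures_of_mapClusterPt (hf : Continuous f)
    (hinv : ∀ i, u i ∈ invariantMeasures d)
    (hlow : ∀ a < beta f, ∀ᶠ i in F, a ≤ ∫ x, f x ∂(u i : Measure (Bernoulli d)))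
    {μ : ProbabilityMeasure (Bernoulli d)} (hμ : MapClusterPt μ F u) :
    μ ∈ maximizingMeasures f := by
  have hμinv := isClosed_invariantMeasures.mem_of_mapClusterPt hμ (Eventually.of_forall hinv)
  refine ⟨hμinv, le_antisymm (integral_le_beta hf hμinv) (le_of_forall_lt_imp_le_of_dense ?_)⟩
  intro a ha
  exact (isClosed_le continuous_const (continuous_integral hf)).mem_of_mapClusterPt hμ (hlow a ha)

theorem exists_mapClusterPt_of_tendsto_integral {g : Bernoulli d → ℝ} (hg : Continuous g)
    {q : ℕ → ι} (hq : Tendsto q atTop F) {l : ℝ}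
    (hl : Tendsto (fun j => ∫ x, g x ∂(u (q j) : Measure (Bernoulli d))) atTop (𝓝 l)) :
    ∃ μ : ProbabilityMeasure (Bernoulli d), MapClusterPt μ F u ∧
      l = ∫ x, g x ∂(μ : Measure (Bernoulli d)) := by
  obtain ⟨μ, -, hμ⟩ := (isCompact_univ (X := ProbabilityMeasure (Bernoulli d))).exists_mapClusterPt
    (f := atTop) (u := u ∘ q) (by simp)
  refine ⟨μ, hμ.of_comp hq, ?_⟩
  have h := hμ.continuousAt_comp (continuous_integral hg).continuousAt
  exact (eq_of_nhds_neBot (ClusterPt.mono h hl)).symm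

/-- In a compact space a family with only one possible cluster point converges to it. -/
theorem tendsto_integral_of_maximizingMeasures_eq_singleton (hf : Continuous f)
    (hinv : ∀ i, u i ∈ invariantMeasures d)
    (hlow : ∀ a < beta f, ∀ᶠ i in F, a ≤ ∫ x, f x ∂(u i : Measure (Bernoulli d)))
    {μ : ProbabilityMeasure (Bernoulli d)} (hμ : maximizingMeasures f = {μ})
    {g : Bernoulli d → ℝ} (hg : Continuous g) :
    Tendsto (fun i => ∫ x, g x ∂(u i : Measure (Bernoulli d))) F
      (𝓝 (∫ x, g x ∂(μ : Measure (Bernoulli d)))) := by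
  have h : Tendsto u F (𝓝 μ) := tendsto_nhds_of_unique_mapClusterPt fun ν hν => by
    have := mem_maximizingMeasures_of_mapClusterPt hf hinv hlow hν
    rwa [hμ] at this
  exact ((continuous_integral hg).tendsto μ).comp h

end ClusterPoints

end Bernoulli

theorem theorem23 (d : ℕ) [NeZero d] (θ : ℝ) (hθ0 : 0 < θ) (hθ1 : θ < 1)
    (f : Bernoulli d → ℝ) (hf : Bernoulli.IsThetaLipschitz θ f) (hpos : ∀ x, 0 < f x) :
    -- accumulation points are maximizing
    ((∀ μ : ProbabilityMeasure (Bernoulli d),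
        MapClusterPt μ ((atTop : Filter ℝ) ×ˢ (atTop : Filter ℕ+))
          (fun p : ℝ × ℕ+ => Bernoulli.piMeasure f p.1 p.2) →
        μ ∈ Bernoulli.maximizingMeasures f) ∧
      (∀ μ : ProbabilityMeasure (Bernoulli d),
        MapClusterPt μ ((atTop : Filter ℝ) ×ˢ (atTop : Filter ℕ+))
          (fun p : ℝ × ℕ+ => Bernoulli.etaMeasure f p.1 p.2) →
        μ ∈ Bernoulli.maximizingMeasures f)) ∧
    -- limits of integrals are integrals against accumulation points
    ((∀ (g : Bernoulli d → ℝ), Continuous g → ∀ (c : ℕ → ℝ) (N : ℕ → ℕ+) (l : ℝ),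
        Tendsto c atTop atTop → Tendsto N atTop atTop →
        Tendsto (fun j => ∫ x, g x ∂(Bernoulli.piMeasure f (c j) (N j) : Measure (Bernoulli d)))
          atTop (𝓝 l) →
        ∃ μ : ProbabilityMeasure (Bernoulli d),
          MapClusterPt μ ((atTop : Filter ℝ) ×ˢ (atTop : Filter ℕ+))
            (fun p : ℝ × ℕ+ => Bernoulli.piMeasure f p.1 p.2) ∧
          l = ∫ x, g x ∂(μ : Measure (Bernoulli d))) ∧
      (∀ (g : Bernoulli d → ℝ), Continuous g → ∀ (c : ℕ → ℝ) (N : ℕ → ℕ+) (l : ℝ),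
        Tendsto c atTop atTop → Tendsto N atTop atTop →
        Tendsto (fun j => ∫ x, g x ∂(Bernoulli.etaMeasure f (c j) (N j) : Measure (Bernoulli d)))
          atTop (𝓝 l) →
        ∃ μ : ProbabilityMeasure (Bernoulli d),
          MapClusterPt μ ((atTop : Filter ℝ) ×ˢ (atTop : Filter ℕ+))
            (fun p : ℝ × ℕ+ => Bernoulli.etaMeasure f p.1 p.2) ∧
          l = ∫ x, g x ∂(μ : Measure (Bernoulli d)))) ∧
    -- convergence when the maximizing measure is unique
    (∀ μinf : ProbabilityMeasure (Bernoulli d), Bernoulli.maximizingMeasures f = {μinf} →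
      ∀ g : Bernoulli d → ℝ, Continuous g →
        Tendsto (fun p : ℝ × ℕ+ =>
            ∫ x, g x ∂(Bernoulli.piMeasure f p.1 p.2 : Measure (Bernoulli d)))
          ((atTop : Filter ℝ) ×ˢ (atTop : Filter ℕ+))
          (𝓝 (∫ x, g x ∂(μinf : Measure (Bernoulli d)))) ∧
        Tendsto (fun p : ℝ × ℕ+ =>
            ∫ x, g x ∂(Bernoulli.etaMeasure f p.1 p.2 : Measure (Bernoulli d)))
          ((atTop : Filter ℝ) ×ˢ (atTop : Filter ℕ+))
          (𝓝 (∫ x, g x ∂(μinf : Measure (Bernoulli d))))) := by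
  obtain ⟨L, hL0, hL⟩ := Bernoulli.abs_sub_le_of_agree hθ0 hθ1 hf
  have hfc := Bernoulli.continuous_of_agree hθ0 hθ1 hL
  have hβ := Bernoulli.beta_pos hfc hpos
  have hπ : ∀ p : ℝ × ℕ+, Bernoulli.piMeasure f p.1 p.2 ∈ Bernoulli.invariantMeasures d :=
    fun p => Bernoulli.measurePreserving_periodicMeasure _ _
  have hη : ∀ p : ℝ × ℕ+, Bernoulli.etaMeasure f p.1 p.2 ∈ Bernoulli.invariantMeasures d :=
    fun p => Bernoulli.measurePreserving_periodicMeasure _ _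
  have hπlow : ∀ a < Bernoulli.beta f, ∀ᶠ p : ℝ × ℕ+ in atTop ×ˢ atTop,
      a ≤ ∫ x, f x ∂(Bernoulli.piMeasure f p.1 p.2 : Measure (Bernoulli d)) := by
    intro a ha
    obtain ⟨ε, hε, -, haε⟩ := Bernoulli.exists_error_le hβ ha
    filter_upwards [Bernoulli.eventually_le_integral_piMeasure hθ0 hθ1 hL0 hL hpos hβ.le hε]
      with p hp using haε.trans hp
  have hηlow : ∀ a < Bernoulli.beta f, ∀ᶠ p : ℝ × ℕ+ in atTop ×ˢ atTop,
      a ≤ ∫ x, f x ∂(Bernoulli.etaMeasure f p.1 p.2 : Measure (Bernoulli d)) := by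
    intro a ha
    obtain ⟨ε, hε, hεβ, haε⟩ := Bernoulli.exists_error_le hβ ha
    filter_upwards [Bernoulli.eventually_le_integral_etaMeasure hθ0 hθ1 hL0 hL hpos hε hεβ]
      with p hp using haε.trans hp
  refine ⟨⟨fun μ hμ => Bernoulli.mem_maximizingMeasures_of_mapClusterPt hfc hπ hπlow hμ,
    fun μ hμ => Bernoulli.mem_maximizingMeasures_of_mapClusterPt hfc hη hηlow hμ⟩,
    ⟨fun g hg c N l hc hN hl =>
      Bernoulli.exists_mapClusterPt_of_tendsto_integral hg (hc.prodMk hN) hl,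
    fun g hg c N l hc hN hl =>
      Bernoulli.exists_mapClusterPt_of_tendsto_integral hg (hc.prodMk hN) hl⟩,
    fun μinf hμ g hg => ⟨?_, ?_⟩⟩
  · exact Bernoulli.tendsto_integral_of_maximizingMeasures_eq_singleton hfc hπ hπlow hμ hg
  · exact Bernoulli.tendsto_integral_of_maximizingMeasures_eq_singleton hfc hη hηlow hμ hg
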